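/- Let $(R,\mathfrak m)$ be a Noetherian local domain of dimension $2$. For a local ring $(R,\mathfrak m)$ of dimension $d$, a sequence $\underline{x}=x_1,\dots,x_d$ of elements of $\mathfrak m$ is a system of parameters if $(\underline{x})$ is $\mathfrak m$-primary. For a finitely generated $R$-module $M$, write $H_i(\underline{x};M)$ for Koszul homology, $\ell$ for length, $\nu_R(M)$ for the minimal number of generators, $\chi_1(\underline{x};M)=\sum_{i=1}^{d}(-1)^{i-1}\ell(H_i(\underline{x};M))$, and, if $\dim M=d$, $e_R(M)=d!\,\lim_{t\to\infty}\ell(M/\mathfrak m^tM)/t^d$. A sequence $\{M_n\}_{n\in\mathbb N}$ of nonzero finitely generated $R$-modules of dimension $d$ is - *lim Cohen–Macaulay* if there is a system of parameters $\underline{x}$ of $R$ with $\lim_{n\to\infty}\ell(H_i(\underline{x};M_n))/\nu_R(M_n)=0$ for all $i\ge 1$; - *weakly lim Cohen–Macaulay* if there is a system of parameters $\underline{x}$ of $R$ with $\lim_{n\to\infty}\chi_1(\underline{x};M_n)/\nu_R(M_n)=0$; - *lim Ulrich* (resp. *weakly lim Ulrich*) if it is lim Cohen–Macaulay (resp. weakly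 lim Cohen–Macaulay) and $\lim_{n\to\infty}e_R(M_n)/\nu_R(M_n)=1$. **Theorem.** Let $\{M_n\}$ be a weakly lim Cohen–Macaulay (resp. weakly lim Ulrich) sequence over the $2$-dimensional local domain $R$. For each $n$ let $C_n\subseteq M_n$ be a torsion submodule such that $\overline{M}_n := M_n/C_n$ has no nonzero submodule of finite length. Then the sequence $\{\overline{M}_n\}$ is lim Cohen–Macaulay (resp. lim Ulrich) over $R$. -/

import Mathlib

open Filter Topology CategoryTheory

universe u v

namespace LimUlrich

section Koszul

variable {R : Type u} [CommRing R] {d : ℕ}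

/-- The `i`-element subsets of `{0, …, d - 1}`: they index the standard basis
`e_S = e_{s₁} ∧ ⋯ ∧ e_{sᵢ}` (`s₁ < ⋯ < sᵢ` the elements of `S`) of the `i`-th exterior power of `R^d`. -/
abbrev KoszulIndex (d i : ℕ) : Type := {S : Finset (Fin d) // S.card = i}

/-- The subset `T ∪ {j}`, for `j ∉ T`. -/
def KoszulIndex.insert {i : ℕ} (T : KoszulIndex d i) (j : {j : Fin d // j ∉ T.1}) :
    KoszulIndex d (i + 1) :=
  ⟨Insert.insert j.1 T.1, by rw [Finset.card_insert_of_notMem j.2, T.2]⟩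

/-- The sign `(-1) ^ #{k ∈ T | k < j}`: that of `e_j` when it is removed from `e_{T ∪ {j}}`. -/
def koszulSign (R : Type u) [CommRing R] (T : Finset (Fin d)) (j : Fin d) : R :=
  (-1) ^ (T.filter (fun k => k < j)).card

/-- The Koszul differential `K_{i+1}(x; M) → K_i(x; M)`. An element of `K_i(x; M) = ⋀ⁱ R^d ⊗ M` is
written as the family of its coordinates with respect to the basis `e_S`, and
`∂ (e_S ⊗ m) = ∑_{j ∈ S} (-1) ^ #{k ∈ S | k < j} e_{S \ {j}} ⊗ x_j m`. -/
def koszulD (x : Fin d → R) (M : Type v) [AddCommGroup M] [Module R M] (i : ℕ) :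
    (KoszulIndex d (i + 1) → M) →ₗ[R] (KoszulIndex d i → M) where
  toFun f T := ∑ j : {j : Fin d // j ∉ T.1}, (koszulSign R T.1 j.1 * x j.1) • f (T.insert j)
  map_add' f g := by
    funext T
    simp [smul_add, Finset.sum_add_distrib]
  map_smul' r f := by
    funext T
    simp only [Pi.smul_apply, RingHom.id_apply, Finset.smul_sum]
    exact Finset.sum_congr rfl fun j _ => smul_comm _ _ _

theorem koszulSign_insert_anticomm (T : Finset (Fin d)) {j k : Fin d} (hj : j ∉ T)
    (h : j < k) :
    koszulSign R T j * koszulSign R (Insert.insert j T) k +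
      koszulSign R T k * koszulSign R (Insert.insert k T) j = 0 := by
  have h1 : ((Insert.insert j T).filter (fun l => l < k)).card
      = (T.filter (fun l => l < k)).card + 1 := by
    rw [Finset.filter_insert, if_pos h, Finset.card_insert_of_notMem (by simp [hj])]
  have h2 : ((Insert.insert k T).filter (fun l => l < j)) = T.filter (fun l => l < j) := by
    rw [Finset.filter_insert, if_neg (not_lt.mpr h.le)]
  simp only [koszulSign, h1, h2]
  ring

theorem koszulD_comp_koszulD (x : Fin d → R) (M : Type v) [AddCommGroup M] [Module R M] (i : ℕ) :
    koszulD x M i ∘ₗ koszulD x M (i + 1) = 0 := by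
  refine LinearMap.ext fun f => funext fun T => ?_
  simp only [LinearMap.comp_apply, koszulD, LinearMap.coe_mk, AddHom.coe_mk, LinearMap.zero_apply,
    Pi.zero_apply, Finset.smul_sum]
  rw [Finset.sum_sigma']
  refine Finset.sum_involution
    (fun p _ => ⟨⟨p.2.1, fun hh => p.2.2 (Finset.mem_insert_of_mem hh)⟩,
      ⟨p.1.1, fun hh => by
        rcases Finset.mem_insert.mp hh with e | e
        · exact p.2.2 (Finset.mem_insert.mpr (Or.inl e.symm))
        · exact p.1.2 e⟩⟩) ?_ ?_ (fun _ _ => Finset.mem_univ _) (fun _ _ => rfl)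
  · rintro ⟨⟨j, hj⟩, ⟨k, hk⟩⟩ _
    have hk' : k ≠ j ∧ k ∉ T.1 := by
      simpa [KoszulIndex.insert, not_or] using hk
    have e : ((T.insert ⟨j, hj⟩).insert ⟨k, hk⟩) =
        ((T.insert ⟨k, hk'.2⟩).insert ⟨j, by
          simp only [KoszulIndex.insert, Finset.mem_insert, not_or]
          exact ⟨hk'.1.symm, hj⟩⟩) :=
      Subtype.ext (Finset.insert_comm _ _ _)
    dsimp only
    rw [← e, smul_smul, smul_smul, ← add_smul]
    have key : koszulSign R T.1 j * koszulSign R (Insert.insert j T.1) k +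
      koszulSign R T.1 k * koszulSign R (Insert.insert k T.1) j = 0 := by
      rcases lt_or_gt_of_ne hk'.1 with h | h
      · rw [add_comm]; exact koszulSign_insert_anticomm _ hk'.2 h
      · exact koszulSign_insert_anticomm _ hj h
    have : koszulSign R T.1 j * x j * (koszulSign R (Insert.insert j T.1) k * x k) +
        koszulSign R T.1 k * x k * (koszulSign R (Insert.insert k T.1) j * x j) = 0 := by
      linear_combination (x j * x k) * key
    simp only [KoszulIndex.insert]
    rw [this, zero_smul]
  · rintro ⟨⟨j, hj⟩, ⟨k, hk⟩⟩ _ _ he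
    have : k = j := congrArg (fun p => p.1.1) he
    exact hk (Finset.mem_insert.mpr (Or.inl this))

/-- The Koszul complex `K_•(x; M)` of the sequence `x = x_1, …, x_d` with coefficients in `M`. -/
noncomputable def koszulComplex (x : Fin d → R) (M : Type v) [AddCommGroup M] [Module R M] :
    ChainComplex (ModuleCat.{v} R) ℕ :=
  ChainComplex.of (fun i => ModuleCat.of R (KoszulIndex d i → M))
    (fun i => ModuleCat.ofHom (koszulD x M i))
    (fun i => by
      rw [← ModuleCat.ofHom_comp, koszulD_comp_koszulD]
      rfl)

/-- `h_i(x; M) = ℓ_R(H_i(x; M))`. (For `M` finitely generated over a Noetherian local ring and `x` a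
system of parameters this length is finite; infinite lengths are sent to `0`.) -/
noncomputable def koszulLength (x : Fin d → R) (M : Type v) [AddCommGroup M] [Module R M]
    (i : ℕ) : ℕ :=
  (Module.length R ((koszulComplex x M).homology i)).toNat

/-- `χ₁(x; M) = ∑_{i = 1}^d (-1)^{i - 1} h_i(x; M)`. -/
noncomputable def chiOne (x : Fin d → R) (M : Type v) [AddCommGroup M] [Module R M] : ℤ :=
  ∑ i ∈ Finset.Icc 1 d, (-1) ^ (i - 1) * (koszulLength x M i : ℤ)

end Koszul

section Local

variable (R : Type u) [CommRing R] [IsLocalRing R]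

/-- `x = x_1, …, x_d` is a system of parameters of the local ring `R`: `d = dim R` and `x` generates
an ideal that is primary to the maximal ideal. -/
def IsSystemOfParameters {d : ℕ} (x : Fin d → R) : Prop :=
  ringKrullDim R = d ∧ (Ideal.span (Set.range x)).radical = IsLocalRing.maximalIdeal R

/-- `ν_R(M)`, the minimal number of generators of `M`. -/
noncomputable def numGenerators (R : Type u) [CommRing R] (M : Type v) [AddCommGroup M]
    [Module R M] : ℕ :=
  (⊤ : Submodule R M).spanFinrank

/-- `e` is the Hilbert–Samuel multiplicity of `M` with respect to the maximal ideal `𝔪` of `R`: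
`e = d! · lim_{n → ∞} ℓ(M / 𝔪ⁿ M) / n^d`, where `d = dim M`. -/
def IsMultiplicity (M : Type v) [AddCommGroup M] [Module R M] (e : ℝ) : Prop :=
  ∃ d : ℕ, Module.supportDim R M = d ∧
    Tendsto (fun n : ℕ => (d.factorial : ℝ) *
      (((Module.length R
        (M ⧸ ((IsLocalRing.maximalIdeal R) ^ n • (⊤ : Submodule R M)))).toNat : ℝ) / (n : ℝ) ^ d))
      atTop (𝓝 e)

variable (M : ℕ → Type v) [∀ n, AddCommGroup (M n)] [∀ n, Module R (M n)]

/-- All modules of the sequence are nonzero, finitely generated and of dimension `dim R`. -/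
def IsFullDimSequence : Prop :=
  ∀ n, Module.Finite R (M n) ∧ Nontrivial (M n) ∧ Module.supportDim R (M n) = ringKrullDim R

/-- Lim Cohen–Macaulay sequences of `R`-modules. -/
def IsLimCohenMacaulay : Prop :=
  IsFullDimSequence R M ∧ ∃ (d : ℕ) (x : Fin d → R), IsSystemOfParameters R x ∧
    ∀ i : ℕ, 1 ≤ i →
      Tendsto (fun n => (koszulLength x (M n) i : ℝ) / (numGenerators R (M n) : ℝ)) atTop (𝓝 0)

/-- Weakly lim Cohen–Macaulay sequences of `R`-modules. -/
def IsWeaklyLimCohenMacaulay : Prop :=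
  IsFullDimSequence R M ∧ ∃ (d : ℕ) (x : Fin d → R), IsSystemOfParameters R x ∧
    Tendsto (fun n => (chiOne x (M n) : ℝ) / (numGenerators R (M n) : ℝ)) atTop (𝓝 0)

/-- The condition `lim_{n → ∞} e_R(M_n) / ν_R(M_n) = 1`. -/
def MultiplicityRatioTendsToOne : Prop :=
  ∃ e : ℕ → ℝ, (∀ n, IsMultiplicity R (M n) (e n)) ∧
    Tendsto (fun n => e n / (numGenerators R (M n) : ℝ)) atTop (𝓝 1)

/-- Lim Ulrich sequences of `R`-modules. -/
def IsLimUlrich : Prop :=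
  IsLimCohenMacaulay R M ∧ MultiplicityRatioTendsToOne R M

/-- Weakly lim Ulrich sequences of `R`-modules. -/
def IsWeaklyLimUlrich : Prop :=
  IsWeaklyLimCohenMacaulay R M ∧ MultiplicityRatioTendsToOne R M

end Local

end LimUlrich

namespace LimUlrich

/-! ### Additivity of length. -/

section Length

variable {R : Type u} [CommRing R] {A B D : Type*} [AddCommGroup A] [Module R A]
  [AddCommGroup B] [Module R B] [AddCommGroup D] [Module R D]

/-! Write `M̄ = M/C`, `I = (x)`, `h_i` for the lengths of Koszul homology and `χ = h₀ - h₁ + h₂`.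
Everything reduces to one inequality for each module of the sequence: `ν(M) - ν(M̄) + h₁(M̄) ≤
χ₁(M)`. Both `ν(M) - ν(M̄)` and `h₁(M̄)` are nonnegative, so after division by `ν(M)` both tend to
`0`; hence `ν(M̄)/ν(M) → 1` and `h₁(M̄)/ν(M̄) → 0`.

To get the inequality, note that `C` is finitely generated torsion, hence killed by some `a ≠ 0`,
and `χ(x; -)` vanishes on such modules (`koszulEuler_eq_zero_of_annihilator`, by a prime
filtration). Additivity (`koszulEuler_eq_add`) gives `χ(M) = χ(M̄)`. Moreover `H₂(M̄)` is a finite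
length submodule of `M̄`, so it is zero. Thus `χ₁(M) = h₁(M̄) + (h₀(M) - h₀(M̄))` (`chiOne_eq_add`).
The last difference is the length of `C/(C ∩ IM)`, which surjects onto `C/(C ∩ 𝔪M)`, of length `ν(M)
- ν(M̄)` (`numGenerators_add_koszulLength_zero_le`). The vanishing of `h₂(M̄)` settles degree two,
and higher Koszul homology of a pair is zero.

For the Ulrich statement, `C` contributes at most linearly in `t` to the length of `M/𝔪ᵗM`, while
the multiplicity is read off at order `t²`. So `e(M̄) = e(M)`, and `ν(M̄)/ν(M) → 1` transfers the
limit of the ratios. -/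

theorem length_range_add_length_range {f : A →ₗ[R] B} {g : B →ₗ[R] D} (h : Function.Exact f g) :
    Module.length R B = Module.length R (LinearMap.range f) + Module.length R (LinearMap.range g) := by
  rw [← LinearMap.exact_iff.mp h]
  exact Module.length_eq_add_of_exact (LinearMap.ker g).subtype g.rangeRestrict
    (Submodule.subtype_injective _) g.surjective_rangeRestrict
    (fun z => by simp [Subtype.ext_iff])

theorem length_le_add_of_exact {f : A →ₗ[R] B} {g : B →ₗ[R] D} (h : Function.Exact f g) :
    Module.length R B ≤ Module.length R A + Module.length R D := by
  rw [length_range_add_length_range h]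
  exact add_le_add (Module.length_le_of_surjective f.rangeRestrict f.surjective_rangeRestrict)
    (Module.length_le_of_injective (LinearMap.range g).subtype (Submodule.subtype_injective _))

/-- The length of `A / P` splits along a submodule `C` of `A`. -/
theorem length_quotient_eq_add (P C : Submodule R A) :
    Module.length R (A ⧸ P) = Module.length R (C ⧸ P.comap C.subtype) +
      Module.length R ((A ⧸ C) ⧸ P.map C.mkQ) := by
  refine Module.length_eq_add_of_exact (Submodule.mapQ _ P C.subtype le_rfl)
    (Submodule.mapQ P _ C.mkQ (Submodule.le_comap_map _ _)) ?_ ?_ ?_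
  · rw [← LinearMap.ker_eq_bot, Submodule.ker_mapQ]
    exact Submodule.mkQ_map_self _
  · intro z
    obtain ⟨z, rfl⟩ := Submodule.mkQ_surjective _ z
    obtain ⟨z, rfl⟩ := Submodule.mkQ_surjective _ z
    exact ⟨Submodule.Quotient.mk z, rfl⟩
  · intro z
    obtain ⟨z, rfl⟩ := Submodule.mkQ_surjective _ z
    simp only [Submodule.mkQ_apply, Submodule.mapQ_apply, Submodule.Quotient.mk_eq_zero,
      Submodule.mem_map, Set.mem_range]
    constructor
    · rintro ⟨y, hy, hyz⟩
      have : z - y ∈ C := (Submodule.Quotient.eq C).1 hyz.symm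
      refine ⟨Submodule.Quotient.mk ⟨z - y, this⟩, ?_⟩
      rw [Submodule.mapQ_apply, Submodule.Quotient.eq]
      simpa using hy
    · rintro ⟨y, hy⟩
      obtain ⟨y, rfl⟩ := Submodule.mkQ_surjective _ y
      rw [Submodule.mkQ_apply, Submodule.mapQ_apply, Submodule.Quotient.eq] at hy
      refine ⟨z - y.1, by simpa using P.neg_mem hy, ?_⟩
      rw [Submodule.Quotient.eq]
      simp

theorem map_mkQ_smul_top (I : Ideal R) (C : Submodule R A) :
    (I • (⊤ : Submodule R A)).map C.mkQ = I • ⊤ := by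
  rw [Submodule.map_smul'', Submodule.map_top, Submodule.range_mkQ]

/-- The length of `A / y ^ t A` grows at most linearly. -/
theorem length_quotient_range_lsmul_pow_le (y : R) (t : ℕ) :
    Module.length R (A ⧸ LinearMap.range (LinearMap.lsmul R A (y ^ t))) ≤
      t * Module.length R (A ⧸ LinearMap.range (LinearMap.lsmul R A y)) := by
  induction t with
  | zero =>
    have : Subsingleton (A ⧸ LinearMap.range (LinearMap.lsmul R A (y ^ 0))) := by
      rw [Submodule.Quotient.subsingleton_iff, LinearMap.range_eq_top]
      exact fun a => ⟨a, by simp⟩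
    simp [Module.length_eq_zero]
  | succ t ih =>
    -- The induction uses the exact sequence `A/yᵗA → A/yᵗ⁺¹A → A/yA`, whose first map is
    -- multiplication by `y`.
    have h1 : LinearMap.range (LinearMap.lsmul R A (y ^ t)) ≤
        (LinearMap.range (LinearMap.lsmul R A (y ^ (t + 1)))).comap (LinearMap.lsmul R A y) := by
      rintro _ ⟨a, rfl⟩
      exact ⟨a, by simp [pow_succ, smul_smul, mul_comm]⟩
    have h2 : LinearMap.range (LinearMap.lsmul R A (y ^ (t + 1))) ≤
        (LinearMap.range (LinearMap.lsmul R A y)).comap LinearMap.id := by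
      rintro _ ⟨a, rfl⟩
      exact ⟨y ^ t • a, by simp [pow_succ, smul_smul, mul_comm]⟩
    have h := length_le_add_of_exact (f := Submodule.mapQ _ _ _ h1) (g := Submodule.mapQ _ _ _ h2) ?_
    · push_cast
      rw [add_mul, one_mul]
      exact h.trans (add_le_add_left ih _)
    · intro z
      obtain ⟨z, rfl⟩ := Submodule.mkQ_surjective _ z
      simp only [Submodule.mkQ_apply, Submodule.mapQ_apply, Submodule.Quotient.mk_eq_zero,
        LinearMap.id_apply, Set.mem_range, LinearMap.mem_range]
      constructor
      · rintro ⟨a, rfl⟩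
        exact ⟨Submodule.Quotient.mk a, rfl⟩
      · rintro ⟨w, hw⟩
        obtain ⟨w, rfl⟩ := Submodule.mkQ_surjective _ w
        rw [Submodule.mkQ_apply, Submodule.mapQ_apply, Submodule.Quotient.eq] at hw
        obtain ⟨b, hb⟩ := hw
        refine ⟨w - y ^ t • b, ?_⟩
        simp only [LinearMap.lsmul_apply, pow_succ', mul_smul, smul_sub] at hb ⊢
        rw [hb]; abel

end Length

/-! ### Finite length and minimal generators over a local ring. -/

section Local

variable {R : Type u} [CommRing R] [IsLocalRing R] [IsNoetherianRing R]
  {N : Type v} [AddCommGroup N] [Module R N] [Module.Finite R N]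

/-- A finitely generated module annihilated by an ideal whose radical contains the maximal ideal
has finite length. -/
theorem length_ne_top_of_maximalIdeal_le_radical {I : Ideal R}
    (hI : IsLocalRing.maximalIdeal R ≤ I.radical) (h : I ≤ Module.annihilator R N) :
    Module.length R N ≠ ⊤ := by
  rcases eq_or_ne I ⊤ with rfl | hne
  · have : Subsingleton N := by
      rw [← Module.annihilator_eq_top_iff (R := R)]
      exact top_le_iff.1 h
    simp [Module.length_eq_zero]
  -- For proper `I` the maximal ideal is a minimal prime of `I`, so `R ⧸ I` is Artinian and `N` has
  -- finite length over it.
  have hmin : IsLocalRing.maximalIdeal R ∈ I.minimalPrimes :=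
    ⟨⟨inferInstance, IsLocalRing.le_maximalIdeal hne⟩, fun Q hQ _ =>
      hI.trans (hQ.1.radical_le_iff.2 hQ.2)⟩
  have := IsLocalRing.quotient_artinian_of_mem_minimalPrimes_of_isLocalRing I hmin
  have hI : Module.IsTorsionBySet R N I := fun n r => Module.mem_annihilator.1 (h r.2) n
  let := hI.module
  have : IsScalarTower R (R ⧸ I) N := hI.isScalarTower
  have : Module.Finite (R ⧸ I) N := Module.Finite.of_restrictScalars_finite R _ _
  have : IsArtinian (R ⧸ I) N := inferInstance
  rw [Module.length_eq_of_surjective (R := R ⧸ I) (S := R) Ideal.Quotient.mk_surjective]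
  exact Module.length_ne_top

omit [IsNoetherianRing R] in
-- Nakayama's lemma. Expressed as a length, `ν` can be compared with `h₀` through the same exact
-- sequences.
theorem numGenerators_eq_length :
    (numGenerators R N : ℕ∞) =
      Module.length R (N ⧸ IsLocalRing.maximalIdeal R • (⊤ : Submodule R N)) := by
  have h := IsLocalRing.spanFinrank_eq_finrank_quotient (⊤ : Submodule R N) Module.Finite.fg_top
  let I := IsLocalRing.maximalIdeal R
  let : Field (R ⧸ I) := Ideal.Quotient.field I
  let Q := (⊤ : Submodule R N) ⧸ I • (⊤ : Submodule R (⊤ : Submodule R N))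
  have : Module.Finite (R ⧸ I) Q := Module.Finite.of_restrictScalars_finite R _ _
  have e : Q ≃ₗ[R] N ⧸ I • (⊤ : Submodule R N) :=
    Submodule.Quotient.equiv _ _ Submodule.topEquiv (by
      rw [Submodule.map_smul'', Submodule.map_top]
      congr 1
      exact LinearEquiv.range _)
  rw [numGenerators, h, ← e.length_eq, Module.length_eq_of_surjective (R := R ⧸ I) (S := R)
    Ideal.Quotient.mk_surjective]
  exact (Module.length_eq_finrank (R ⧸ I) Q).symm

end Local

/-! ### Primes and annihilators in dimension two. -/

section Dim

variable {R : Type u} [CommRing R] [IsDomain R] [IsLocalRing R] [IsNoetherianRing R]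

omit [IsNoetherianRing R] in
-- Otherwise `0 < P < Q < 𝔪` would force the height of `𝔪` to be at least three.
theorem eq_maximalIdeal_of_lt (hdim : ringKrullDim R = 2) {P Q : Ideal R} [P.IsPrime] [Q.IsPrime]
    (hP : P ≠ ⊥) (hPQ : P < Q) : Q = IsLocalRing.maximalIdeal R := by
  by_contra hQ
  have hQ' : Q < IsLocalRing.maximalIdeal R :=
    lt_of_le_of_ne (IsLocalRing.le_maximalIdeal (Ideal.IsPrime.ne_top ‹_›)) hQ
  have h0 := Ideal.height_add_one_le_of_lt_of_isPrime (bot_lt_iff_ne_bot.2 hP)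
  have h1 := Ideal.height_add_one_le_of_lt_of_isPrime hPQ
  have h2 := Ideal.height_add_one_le_of_lt_of_isPrime hQ'
  have h3 := IsLocalRing.maximalIdeal_height_eq_ringKrullDim (R := R)
  rw [hdim] at h3
  have h4 : (IsLocalRing.maximalIdeal R).height = 2 := WithBot.coe_inj.1 (h3.trans rfl)
  rw [h4] at h2
  have h5 : (0 : ℕ∞) + 1 + 1 + 1 ≤ 2 := by
    refine le_trans ?_ h2
    gcongr
    refine le_trans ?_ h1
    gcongr
    refine le_trans ?_ h0
    gcongr
    exact zero_le
  exact absurd h5 (by decide)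

omit [IsNoetherianRing R] in
/-- A nonzero prime and an element of the maximal ideal outside it generate a primary ideal. -/
theorem maximalIdeal_le_radical_of_notMem (hdim : ringKrullDim R = 2) {I P : Ideal R} [P.IsPrime]
    (hP : P ≠ ⊥) (hPI : P ≤ I) {y : R} (hyP : y ∉ P) (hy : y ∈ I) :
    IsLocalRing.maximalIdeal R ≤ I.radical := by
  rw [Ideal.radical_eq_sInf]
  refine le_sInf fun Q ⟨hQ, _⟩ => ?_
  exact (eq_maximalIdeal_of_lt hdim hP
    (lt_of_le_of_ne (hPI.trans hQ) fun e => hyP (e ▸ hQ hy))).ge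

/-- Each nonzero `a` can be completed by some `y` so that `a, y` is primary to the maximal ideal. -/
theorem exists_maximalIdeal_le_radical_span_pair (hdim : ringKrullDim R = 2) {a : R} (ha : a ≠ 0) :
    ∃ y ∈ IsLocalRing.maximalIdeal R,
      IsLocalRing.maximalIdeal R ≤ (Ideal.span {a, y}).radical := by
  have hfin := (Ideal.span {a}).finite_minimalPrimes_of_isNoetherianRing R
  -- Prime avoidance: by Krull's principal ideal theorem the minimal primes of `(a)` have height at
  -- most one, so none is `𝔪`. Any `y ∈ 𝔪` outside all of them works.
  have hns : ¬ ((IsLocalRing.maximalIdeal R : Ideal R) : Set R) ⊆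
      ⋃ P ∈ (hfin.toFinset : Set (Ideal R)), ((id P : Ideal R) : Set R) := by
    rw [Ideal.subset_union_prime (f := id) ⊤ ⊤ fun P hP _ _ => ((hfin.mem_toFinset).1 hP).1.1]
    rintro ⟨P, hP, hle⟩
    have hP := hfin.mem_toFinset.1 hP
    have := hP.1.1
    have e : P = IsLocalRing.maximalIdeal R :=
      le_antisymm (IsLocalRing.le_maximalIdeal (Ideal.IsPrime.ne_top this)) hle
    have h1 := Ideal.height_le_one_of_isPrincipal_of_mem_minimalPrimes _ _ hP
    have h2 := IsLocalRing.maximalIdeal_height_eq_ringKrullDim (R := R)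
    rw [hdim, ← e] at h2
    have h3 : P.height = 2 := WithBot.coe_inj.1 (h2.trans rfl)
    rw [h3] at h1
    exact absurd h1 (by decide)
  obtain ⟨y, hy, hyn⟩ := Set.not_subset.1 hns
  refine ⟨y, hy, ?_⟩
  rw [Ideal.radical_eq_sInf]
  refine le_sInf fun Q ⟨hQ, hQp⟩ => ?_
  obtain ⟨P, hP, hPQ⟩ := Ideal.exists_minimalPrimes_le
    (show Ideal.span {a} ≤ Q from (Ideal.span_mono (by simp)).trans hQ)
  have := hP.1.1
  refine (eq_maximalIdeal_of_lt hdim (P := P) ?_ (lt_of_le_of_ne hPQ ?_)).ge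
  · rintro rfl
    exact ha ((Submodule.mem_bot R).1 (hP.1.2 (Ideal.mem_span_singleton_self a)))
  · rintro rfl
    refine hyn (Set.mem_biUnion (hfin.mem_toFinset.2 hP) (hQ (Ideal.subset_span (by simp))))

variable {N : Type v} [AddCommGroup N] [Module R N] [Module.Finite R N]

omit [IsLocalRing R] [IsNoetherianRing R] in
-- In a domain, dividing by a nonzero element of the annihilator lowers the finite dimension by at
-- least one. This turns the full dimension condition into one that is easy to follow through
-- quotients.
theorem supportDim_eq_iff_annihilator_eq_bot (hdim : ringKrullDim R = 2) :
    Module.supportDim R N = ringKrullDim R ↔ Module.annihilator R N = ⊥ := by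
  rw [Module.supportDim_eq_ringKrullDim_quotient_annihilator]
  constructor
  · intro h
    by_contra hne
    obtain ⟨a, ha, ha0⟩ := Submodule.exists_mem_ne_zero_of_ne_bot hne
    have h1 := ringKrullDim_quotient_succ_le_of_nonZeroDivisor (mem_nonZeroDivisors_of_ne_zero ha0)
    have h2 : ringKrullDim (R ⧸ Module.annihilator R N) ≤ ringKrullDim (R ⧸ Ideal.span {a}) :=
      ringKrullDim_le_of_surjective (Ideal.Quotient.factor
        ((Ideal.span_singleton_le_iff_mem _).2 ha)) (Ideal.Quotient.factor_surjective _)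
    rw [h] at h2
    have := (add_le_add_left h2 1).trans h1
    rw [hdim] at this
    exact absurd this (by decide)
  · intro h
    rw [h]
    exact ringKrullDim_eq_of_ringEquiv (RingEquiv.quotientBot R)

omit [IsDomain R] [IsNoetherianRing R] in
/-- A finitely generated torsion module has a nonzero annihilator. -/
theorem exists_mem_annihilator_of_isTorsion (h : Module.IsTorsion R N) :
    ∃ a ∈ Module.annihilator R N, a ≠ 0 := by
  obtain ⟨a, ha, ha'⟩ := Submodule.annihilator_top_inter_nonZeroDivisors h
  exact ⟨a, by rwa [Submodule.annihilator_top] at ha, nonZeroDivisors.ne_zero ha'⟩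

end Dim

/-! ### Explicit Koszul homology of a pair. -/

section KoszulPair

variable {R : Type u} [CommRing R]

instance : Unique (KoszulIndex 2 0) where
  default := ⟨∅, rfl⟩
  uniq := by decide

instance : Unique (KoszulIndex 2 2) where
  default := ⟨Finset.univ, rfl⟩
  uniq := by decide

instance (i : ℕ) : IsEmpty (KoszulIndex 2 (i + 3)) :=
  ⟨fun S => by have := S.2 ▸ Finset.card_le_univ S.1; simp at this⟩

variable (x : Fin 2 → R) (M : Type v) [AddCommGroup M] [Module R M]

/-- The differential `m ↦ (-x₁ m, x₀ m)` of the Koszul complex of a pair. -/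
def koszulPairLeft : M →ₗ[R] M × M :=
  (-LinearMap.lsmul R M (x 1)).prod (LinearMap.lsmul R M (x 0))

/-- The differential `(m, n) ↦ x₀ m + x₁ n` of the Koszul complex of a pair. -/
def koszulPairRight : M × M →ₗ[R] M :=
  (LinearMap.lsmul R M (x 0)).coprod (LinearMap.lsmul R M (x 1))

variable {M} in
@[simp] theorem koszulPairLeft_apply (m : M) : koszulPairLeft x M m = (-(x 1 • m), x 0 • m) := rfl

variable {M} in
@[simp] theorem koszulPairRight_apply (p : M × M) :
    koszulPairRight x M p = x 0 • p.1 + x 1 • p.2 := by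
  simp [koszulPairRight]

theorem koszulPairRight_comp_koszulPairLeft : koszulPairRight x M ∘ₗ koszulPairLeft x M = 0 := by
  ext m
  simp [smul_smul, mul_comm]

variable (R) in
/-- The coordinates of `K₁` for a pair. -/
def koszulOneEquiv : (KoszulIndex 2 1 → M) ≃ₗ[R] M × M where
  toFun f := (f ⟨{0}, Finset.card_singleton _⟩, f ⟨{1}, Finset.card_singleton _⟩)
  map_add' _ _ := rfl
  map_smul' _ _ := rfl
  invFun p T := if 0 ∈ T.1 then p.1 else p.2
  left_inv f := by
    funext T
    have hT : T = ⟨{0}, Finset.card_singleton _⟩ ∨ T = ⟨{1}, Finset.card_singleton _⟩ := by revert T; decide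
    rcases hT with rfl | rfl <;> simp
  right_inv p := by simp

variable {M} in
theorem koszulD_zero_apply (f : KoszulIndex 2 1 → M) :
    koszulD x M 0 f default = koszulPairRight x M (koszulOneEquiv R M f) := by
  have h : (Finset.univ : Finset {j : Fin 2 // j ∉ (default : KoszulIndex 2 0).1}) =
      {⟨0, by decide⟩, ⟨1, by decide⟩} := by decide
  change ∑ j : {j : Fin 2 // j ∉ (default : KoszulIndex 2 0).1},
    (koszulSign R (default : KoszulIndex 2 0).1 j.1 * x j.1) •
      f (KoszulIndex.insert default j) = _
  rw [h, Finset.sum_insert (by decide), Finset.sum_singleton, koszulPairRight_apply]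
  congr 1
  · rw [show koszulSign R (default : KoszulIndex 2 0).1 0 = 1 from pow_zero _, one_mul]; rfl
  · rw [show koszulSign R (default : KoszulIndex 2 0).1 1 = 1 from pow_zero _, one_mul]; rfl

variable {M} in
theorem koszulOneEquiv_koszulD_one (f : KoszulIndex 2 2 → M) :
    koszulOneEquiv R M (koszulD x M 1 f) = koszulPairLeft x M (f default) := by
  have h0 : (Finset.univ : Finset {j : Fin 2 // j ∉ ({0} : Finset (Fin 2))}) =
      {⟨1, by decide⟩} := by decide
  have h1 : (Finset.univ : Finset {j : Fin 2 // j ∉ ({1} : Finset (Fin 2))}) =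
      {⟨0, by decide⟩} := by decide
  refine Prod.ext ?_ ?_
  · change ∑ j : {j : Fin 2 // j ∉ ({0} : Finset (Fin 2))},
      (koszulSign R ({0} : Finset (Fin 2)) j.1 * x j.1) •
        f (KoszulIndex.insert ⟨{0}, Finset.card_singleton _⟩ j) = _
    rw [h0, Finset.sum_singleton,
      show koszulSign R ({0} : Finset (Fin 2)) 1 = -1 from pow_one _, neg_one_mul, neg_smul]
    exact congrArg (fun S => -(x 1 • f S)) (Subsingleton.elim (α := KoszulIndex 2 2) _ _)
  · change ∑ j : {j : Fin 2 // j ∉ ({1} : Finset (Fin 2))},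
      (koszulSign R ({1} : Finset (Fin 2)) j.1 * x j.1) •
        f (KoszulIndex.insert ⟨{1}, Finset.card_singleton _⟩ j) = _
    rw [h1, Finset.sum_singleton,
      show koszulSign R ({1} : Finset (Fin 2)) 0 = 1 from pow_zero _, one_mul]
    rfl

theorem koszulComplex_d {d : ℕ} (x : Fin d → R) (i : ℕ) :
    (koszulComplex x M).d (i + 1) i = ModuleCat.ofHom (koszulD x M i) :=
  ChainComplex.of_d (fun i => ModuleCat.of R (KoszulIndex d i → M))
    (fun i => ModuleCat.ofHom (koszulD x M i)) i

/-- The Koszul homology of a pair in degree one. -/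
theorem nonempty_koszulHomology_one_equiv :
    Nonempty ((koszulComplex x M).homology 1 ≃ₗ[R] LinearMap.ker (koszulPairRight x M) ⧸
      (LinearMap.range (koszulPairLeft x M)).comap (LinearMap.ker (koszulPairRight x M)).subtype) := by
  let S : ShortComplex (ModuleCat.{v} R) := ShortComplex.mk (ModuleCat.ofHom (koszulPairLeft x M))
    (ModuleCat.ofHom (koszulPairRight x M))
    (by rw [← ModuleCat.ofHom_comp, koszulPairRight_comp_koszulPairLeft]; rfl)
  let e : (koszulComplex x M).sc' 2 1 0 ≅ S := ShortComplex.isoMk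
    (LinearEquiv.toModuleIso (LinearEquiv.funUnique (KoszulIndex 2 2) R M))
    (LinearEquiv.toModuleIso (koszulOneEquiv R M))
    (LinearEquiv.toModuleIso (LinearEquiv.funUnique (KoszulIndex 2 0) R M))
    (by
      change _ = (koszulComplex x M).d 2 1 ≫ _
      rw [koszulComplex_d]
      refine ModuleCat.hom_ext (LinearMap.ext fun f => ?_)
      exact (koszulOneEquiv_koszulD_one x f).symm)
    (by
      change _ = (koszulComplex x M).d 1 0 ≫ _
      rw [koszulComplex_d]
      refine ModuleCat.hom_ext (LinearMap.ext fun f => ?_)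
      exact (koszulD_zero_apply x f).symm)
  refine ⟨(((koszulComplex x M).homologyIsoSc' 2 1 0 (by simp) (by simp)) ≪≫
    (ShortComplex.homologyMapIso e) ≪≫ S.moduleCatHomologyIso).toLinearEquiv.trans
      (Submodule.quotEquivOfEq _ _ ?_)⟩
  ext z
  simp only [LinearMap.mem_range, Submodule.mem_comap, Subtype.ext_iff]
  rfl

/-- The Koszul homology of a pair in degree two. -/
theorem nonempty_koszulHomology_two_equiv :
    Nonempty ((koszulComplex x M).homology 2 ≃ₗ[R] LinearMap.ker (koszulPairLeft x M)) := by
  let S : ShortComplex (ModuleCat.{v} R) := ShortComplex.mk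
    (0 : ModuleCat.of R (KoszulIndex 2 3 → M) ⟶ ModuleCat.of R M)
    (ModuleCat.ofHom (koszulPairLeft x M)) (by simp)
  let e : (koszulComplex x M).sc' 3 2 1 ≅ S := ShortComplex.isoMk
    (Iso.refl _)
    (LinearEquiv.toModuleIso (LinearEquiv.funUnique (KoszulIndex 2 2) R M))
    (LinearEquiv.toModuleIso (koszulOneEquiv R M))
    (by
      have : Subsingleton (KoszulIndex 2 3 → M) := inferInstance
      ext f
      have : f = 0 := Subsingleton.elim (α := KoszulIndex 2 3 → M) _ _
      rw [this, map_zero, map_zero])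
    (by
      change _ = (koszulComplex x M).d 2 1 ≫ _
      rw [koszulComplex_d]
      refine ModuleCat.hom_ext (LinearMap.ext fun f => ?_)
      exact (koszulOneEquiv_koszulD_one x f).symm)
  refine ⟨(((koszulComplex x M).homologyIsoSc' 3 2 1 (by simp) (by simp)) ≪≫
    (ShortComplex.homologyMapIso e) ≪≫ S.moduleCatHomologyIso).toLinearEquiv.trans
      (Submodule.quotEquivOfEqBot _ ?_)⟩
  rw [LinearMap.range_eq_bot]
  rfl

/-- The Koszul homology of a pair in degree zero. -/
theorem nonempty_koszulHomology_zero_equiv :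
    Nonempty ((koszulComplex x M).homology 0 ≃ₗ[R] M ⧸ LinearMap.range (koszulPairRight x M)) := by
  let S : ShortComplex (ModuleCat.{v} R) := ShortComplex.mk
    (ModuleCat.ofHom (koszulPairRight x M))
    (0 : ModuleCat.of R M ⟶ ModuleCat.of R M) (by simp)
  -- Degree `0` has no successor in `ComplexShape.down ℕ`, so its `next` is `0` by convention and
  -- the outgoing map `d 0 0` is zero.
  let e : (koszulComplex x M).sc' 1 0 0 ≅ S := ShortComplex.isoMk
    (LinearEquiv.toModuleIso (koszulOneEquiv R M))
    (LinearEquiv.toModuleIso (LinearEquiv.funUnique (KoszulIndex 2 0) R M))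
    (LinearEquiv.toModuleIso (LinearEquiv.funUnique (KoszulIndex 2 0) R M))
    (by
      change _ = (koszulComplex x M).d 1 0 ≫ _
      rw [koszulComplex_d]
      refine ModuleCat.hom_ext (LinearMap.ext fun f => ?_)
      exact (koszulD_zero_apply x f).symm)
    (by
      change _ = (koszulComplex x M).d 0 0 ≫ _
      rw [(koszulComplex x M).shape _ _ (by simp)]
      exact Limits.comp_zero.trans Limits.zero_comp.symm)
  refine ⟨(((koszulComplex x M).homologyIsoSc' 1 0 0 (by simp) (by simp)) ≪≫
    (ShortComplex.homologyMapIso e) ≪≫ S.moduleCatHomologyIso).toLinearEquiv.trans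
      (Submodule.Quotient.equiv _ _ (LinearEquiv.ofTop _ LinearMap.ker_zero) ?_)⟩
  ext z
  simp only [Submodule.mem_map, LinearMap.mem_range]
  constructor
  · rintro ⟨_, ⟨p, rfl⟩, rfl⟩
    exact ⟨p, rfl⟩
  · rintro ⟨p, rfl⟩
    exact ⟨_, ⟨p, rfl⟩, rfl⟩

/-- The Koszul homology of a pair vanishes from degree three on. -/
theorem subsingleton_koszulHomology (i : ℕ) :
    Subsingleton ((koszulComplex x M).homology (i + 3)) := by
  have h : Limits.IsZero ((koszulComplex x M).X (i + 3)) :=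
    ModuleCat.isZero_iff_subsingleton.2
      (inferInstanceAs (Subsingleton (KoszulIndex 2 (i + 3) → M)))
  exact ModuleCat.isZero_iff_subsingleton.1
    ((ShortComplex.exact_iff_isZero_homology _).1
      (ShortComplex.exact_of_isZero_X₂ ((koszulComplex x M).sc (i + 3)) h))

end KoszulPair

/-! ### Lengths in a long exact sequence. -/

section LongExact

variable {R : Type u} [CommRing R] {A₂ B₂ C₂ A₁ B₁ C₁ A₀ B₀ C₀ : Type*}
  [AddCommGroup A₂] [Module R A₂] [AddCommGroup B₂] [Module R B₂] [AddCommGroup C₂] [Module R C₂]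
  [AddCommGroup A₁] [Module R A₁] [AddCommGroup B₁] [Module R B₁] [AddCommGroup C₁] [Module R C₁]
  [AddCommGroup A₀] [Module R A₀] [AddCommGroup B₀] [Module R B₀] [AddCommGroup C₀] [Module R C₀]
  {f₂ : A₂ →ₗ[R] B₂} {g₂ : B₂ →ₗ[R] C₂} {δ₂ : C₂ →ₗ[R] A₁} {f₁ : A₁ →ₗ[R] B₁} {g₁ : B₁ →ₗ[R] C₁}
  {δ₁ : C₁ →ₗ[R] A₀} {f₀ : A₀ →ₗ[R] B₀} {g₀ : B₀ →ₗ[R] C₀}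

/-- Since `ENat.toNat` sends `⊤` to `0`, additivity survives only when `B` has finite length. -/
theorem toNat_length_eq_add {A B D : Type*} [AddCommGroup A] [Module R A] [AddCommGroup B]
    [Module R B] [AddCommGroup D] [Module R D] {f : A →ₗ[R] B} {g : B →ₗ[R] D}
    (h : Function.Exact f g) (hB : Module.length R B ≠ ⊤) :
    (Module.length R B).toNat = (Module.length R (LinearMap.range f)).toNat +
      (Module.length R (LinearMap.range g)).toNat := by
  rw [length_range_add_length_range h] at hB ⊢
  exact ENat.toNat_add (WithTop.add_ne_top.1 hB).1 (WithTop.add_ne_top.1 hB).2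

/-- The alternating sum of the lengths in a long exact sequence of three rows vanishes. -/
theorem toNat_length_alternating_sum_of_exact (hf₂ : Function.Injective f₂)
    (hB₂ : Function.Exact f₂ g₂) (hC₂ : Function.Exact g₂ δ₂) (hA₁ : Function.Exact δ₂ f₁)
    (hB₁ : Function.Exact f₁ g₁) (hC₁ : Function.Exact g₁ δ₁) (hA₀ : Function.Exact δ₁ f₀)
    (hB₀ : Function.Exact f₀ g₀) (hg₀ : Function.Surjective g₀)
    (lB₂ : Module.length R B₂ ≠ ⊤) (lC₂ : Module.length R C₂ ≠ ⊤)
    (lA₁ : Module.length R A₁ ≠ ⊤) (lB₁ : Module.length R B₁ ≠ ⊤) (lC₁ : Module.length R C₁ ≠ ⊤)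
    (lA₀ : Module.length R A₀ ≠ ⊤) (lB₀ : Module.length R B₀ ≠ ⊤) :
    ((Module.length R B₀).toNat : ℤ) - (Module.length R B₁).toNat + (Module.length R B₂).toNat =
      (Module.length R A₀).toNat - (Module.length R A₁).toNat + (Module.length R A₂).toNat +
      ((Module.length R C₀).toNat - (Module.length R C₁).toNat + (Module.length R C₂).toNat) := by
  have eA₂ := (LinearEquiv.ofInjective f₂ hf₂).length_eq
  have eC₀ := (LinearEquiv.ofTop _ (LinearMap.range_eq_top.2 hg₀)).length_eq
  -- With the two end terms replaced by ranges, every length is written in terms of lengths of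
  -- ranges of the maps, and the alternating sum telescopes.
  rw [eA₂, ← eC₀, toNat_length_eq_add hB₂ lB₂, toNat_length_eq_add hC₂ lC₂,
    toNat_length_eq_add hA₁ lA₁, toNat_length_eq_add hB₁ lB₁, toNat_length_eq_add hC₁ lC₁,
    toNat_length_eq_add hA₀ lA₀, toNat_length_eq_add hB₀ lB₀]
  push_cast
  ring

end LongExact

/-! ### Koszul complexes of a short exact sequence of coefficients. -/

section Functoriality

variable {R : Type u} [CommRing R] {d : ℕ} (x : Fin d → R)
  {M N P : Type v} [AddCommGroup M] [Module R M] [AddCommGroup N] [Module R N]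
  [AddCommGroup P] [Module R P]

/-- The map of Koszul complexes induced by a linear map of coefficients. -/
noncomputable def koszulMap (f : M →ₗ[R] N) : koszulComplex x M ⟶ koszulComplex x N :=
  ChainComplex.ofHom
    (fun i => (ModuleCat.ofHom (f.compLeft (KoszulIndex d i)) :
      ModuleCat.of R (KoszulIndex d i → M) ⟶ ModuleCat.of R (KoszulIndex d i → N)))
    (fun i => by
      rw [koszulComplex_d, koszulComplex_d]
      refine ModuleCat.hom_ext (LinearMap.ext fun p => funext fun T => ?_)
      change koszulD x N i (f ∘ p) T = f (koszulD x M i p T)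
      simp only [koszulD, LinearMap.coe_mk, AddHom.coe_mk, map_sum, map_smul]
      rfl)

/-- The short complex of Koszul complexes attached to an exact pair of linear maps. -/
noncomputable def koszulShortComplex {f : M →ₗ[R] N} {g : N →ₗ[R] P} (h : Function.Exact f g) :
    ShortComplex (ChainComplex (ModuleCat.{v} R) ℕ) :=
  ShortComplex.mk (koszulMap x f) (koszulMap x g) (by
    refine HomologicalComplex.hom_ext _ _ fun i => ?_
    refine ModuleCat.hom_ext (LinearMap.ext fun p => funext fun T => ?_)
    exact h.apply_apply_eq_zero (p T))

theorem koszulShortComplex_shortExact {f : M →ₗ[R] N} {g : N →ₗ[R] P} (h : Function.Exact f g)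
    (hf : Function.Injective f) (hg : Function.Surjective g) :
    (koszulShortComplex x h).ShortExact := by
  refine HomologicalComplex.shortExact_of_degreewise_shortExact _ fun i => ?_
  refine ModuleCat.shortComplex_shortExact _ ?_ ?_ ?_
  · intro p
    change g.compLeft (KoszulIndex d i) p = 0 ↔ p ∈ Set.range (f.compLeft (KoszulIndex d i))
    constructor
    · intro hp
      choose q hq using fun T => (h (p T)).1 (congrFun hp T)
      exact ⟨q, funext hq⟩
    · rintro ⟨q, rfl⟩
      exact funext fun T => h.apply_apply_eq_zero (q T)
  · exact fun p q hpq => funext fun T => hf (congrFun hpq T)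
  · intro p
    choose q hq using fun T => hg (p T)
    exact ⟨q, funext hq⟩

end Functoriality

/-! ### Additivity of the Koszul Euler characteristic. -/

section EulerCharacteristic

variable {R : Type u} [CommRing R] (x : Fin 2 → R)

/-- The Euler characteristic of the Koszul homology of a pair. -/
noncomputable def koszulEuler (M : Type v) [AddCommGroup M] [Module R M] : ℤ :=
  koszulLength x M 0 - koszulLength x M 1 + koszulLength x M 2

theorem chiOne_eq (M : Type v) [AddCommGroup M] [Module R M] :
    chiOne x M = koszulLength x M 1 - koszulLength x M 2 := by
  have h : Finset.Icc 1 2 = ({1, 2} : Finset ℕ) := by decide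
  rw [chiOne, h, Finset.sum_insert (by decide), Finset.sum_singleton]
  ring

theorem koszulLength_add_three (M : Type v) [AddCommGroup M] [Module R M] (i : ℕ) :
    koszulLength x M (i + 3) = 0 := by
  have := subsingleton_koszulHomology x M i
  rw [koszulLength, Module.length_eq_zero, ENat.toNat_zero]

variable {M N P : Type v} [AddCommGroup M] [Module R M] [AddCommGroup N] [Module R N]
  [AddCommGroup P] [Module R P]

/-- The long exact homology sequence has only three nonzero rows: it starts with an injection on
`H₂` because `H₃(P) = 0`, and ends with a surjection on `H₀`. -/
theorem koszulEuler_eq_add {f : M →ₗ[R] N} {g : N →ₗ[R] P} (h : Function.Exact f g)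
    (hf : Function.Injective f) (hg : Function.Surjective g)
    (hM : ∀ i, Module.length R ((koszulComplex x M).homology i) ≠ ⊤)
    (hN : ∀ i, Module.length R ((koszulComplex x N).homology i) ≠ ⊤)
    (hP : ∀ i, Module.length R ((koszulComplex x P).homology i) ≠ ⊤) :
    koszulEuler x N = koszulEuler x M + koszulEuler x P := by
  have hS := koszulShortComplex_shortExact x h hf hg
  have E1 (i j : ℕ) (hij : (ComplexShape.down ℕ).Rel i j) :=
    (ShortComplex.ShortExact.moduleCat_exact_iff_function_exact _).1 (hS.homology_exact₁ i j hij)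
  have E2 (i : ℕ) :=
    (ShortComplex.ShortExact.moduleCat_exact_iff_function_exact _).1 (hS.homology_exact₂ i)
  have E3 (i j : ℕ) (hij : (ComplexShape.down ℕ).Rel i j) :=
    (ShortComplex.ShortExact.moduleCat_exact_iff_function_exact _).1 (hS.homology_exact₃ i j hij)
  have hinj : Function.Injective
      (HomologicalComplex.homologyMap (koszulShortComplex x h).f 2).hom := by
    have := subsingleton_koszulHomology x P 0
    rw [injective_iff_map_eq_zero]
    intro z hz
    obtain ⟨w, rfl⟩ := (E1 3 2 (by simp) z).1 hz
    rw [Subsingleton.elim (α := (koszulComplex x P).homology 3) w 0]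
    exact map_zero (hS.δ 3 2 (by simp)).hom
  have hsurj : Function.Surjective
      (HomologicalComplex.homologyMap (koszulShortComplex x h).g 0).hom := by
    have := hS.epi_g
    rw [← ModuleCat.epi_iff_surjective]
    exact HomologicalComplex.epi_homologyMap_of_epi_of_not_rel _ _ (by simp)
  exact toNat_length_alternating_sum_of_exact hinj (E2 2) (E3 2 1 (by simp)) (E1 2 1 (by simp))
    (E2 1) (E3 1 0 (by simp)) (E1 1 0 (by simp)) (E2 0) hsurj (hN 2) (hP 2) (hM 1) (hN 1)
    (hP 1) (hM 0) (hN 0)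

end EulerCharacteristic

/-! ### Finiteness of Koszul homology. -/

section FiniteLength

variable {R : Type u} [CommRing R] [IsLocalRing R] [IsNoetherianRing R] {x : Fin 2 → R}
  (hx : IsLocalRing.maximalIdeal R ≤ (Ideal.span (Set.range x)).radical)
  (M : Type v) [AddCommGroup M] [Module R M] [Module.Finite R M]

include hx

theorem length_ne_top_of_smul_eq_zero (h0 : ∀ m : M, x 0 • m = 0)
    (h1 : ∀ m : M, x 1 • m = 0) : Module.length R M ≠ ⊤ := by
  refine length_ne_top_of_maximalIdeal_le_radical hx (Ideal.span_le.2 ?_)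
  rintro _ ⟨i, rfl⟩
  fin_cases i
  · exact Module.mem_annihilator.2 h0
  · exact Module.mem_annihilator.2 h1

/-- Koszul homology is finitely generated and killed by both `x 0` and `x 1`, hence by an ideal
whose radical contains `𝔪`. -/
theorem length_koszulHomology_ne_top (i : ℕ) :
    Module.length R ((koszulComplex x M).homology i) ≠ ⊤ := by
  match i with
  | 0 =>
    obtain ⟨e⟩ := nonempty_koszulHomology_zero_equiv x M
    rw [e.length_eq]
    refine length_ne_top_of_smul_eq_zero hx _ (fun z => ?_) fun z => ?_ <;>
      obtain ⟨m, rfl⟩ := Submodule.mkQ_surjective _ z <;>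
      rw [← map_smul, Submodule.mkQ_apply, Submodule.Quotient.mk_eq_zero]
    · exact ⟨(m, 0), by simp⟩
    · exact ⟨(0, m), by simp⟩
  | 1 =>
    obtain ⟨e⟩ := nonempty_koszulHomology_one_equiv x M
    rw [e.length_eq]
    refine length_ne_top_of_smul_eq_zero hx _ (fun z => ?_) fun z => ?_ <;>
      obtain ⟨⟨⟨p, q⟩, h⟩, rfl⟩ := Submodule.mkQ_surjective _ z <;>
      rw [← map_smul, Submodule.mkQ_apply, Submodule.Quotient.mk_eq_zero] <;>
      rw [LinearMap.mem_ker, koszulPairRight_apply] at h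
    -- For a cycle `(p, q)`, so that `x₀p + x₁q = 0`, one has `x₀(p, q) = (-x₁q, x₀q) = ∂q` and
    -- `x₁(p, q) = (x₁p, -x₀p) = ∂(-p)`.
    · exact ⟨q, Prod.ext (neg_eq_of_add_eq_zero_left h) rfl⟩
    · exact ⟨-p, Prod.ext (by simp) (by
        simpa using neg_eq_of_add_eq_zero_right h)⟩
  | 2 =>
    obtain ⟨e⟩ := nonempty_koszulHomology_two_equiv x M
    rw [e.length_eq]
    refine length_ne_top_of_smul_eq_zero hx _ ?_ ?_ <;> rintro ⟨m, hm⟩ <;>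
      rw [LinearMap.mem_ker, koszulPairLeft_apply, Prod.mk_eq_zero, neg_eq_zero] at hm <;>
      apply Subtype.ext
    · exact hm.2
    · exact hm.1
  | i + 3 =>
    have := subsingleton_koszulHomology x M i
    simp [Module.length_eq_zero]

end FiniteLength

/-! ### Vanishing of the Euler characteristic in three basic cases. -/

section EulerVanishing

theorem length_eq_length_add_quotient {R : Type*} [CommRing R] {A : Type*} [AddCommGroup A]
    [Module R A] (P : Submodule R A) :
    Module.length R A = Module.length R P + Module.length R (A ⧸ P) :=
  Module.length_eq_add_of_exact P.subtype P.mkQ P.subtype_injective P.mkQ_surjective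
    (LinearMap.exact_subtype_mkQ P)

theorem length_eq_length_ker_add_range {R : Type*} [CommRing R] {A B : Type*} [AddCommGroup A]
    [Module R A] [AddCommGroup B] [Module R B] (f : A →ₗ[R] B) :
    Module.length R A =
      Module.length R (LinearMap.ker f) + Module.length R (LinearMap.range f) :=
  Module.length_eq_add_of_exact (LinearMap.ker f).subtype f.rangeRestrict
    (Submodule.subtype_injective _) f.surjective_rangeRestrict (fun z => by simp [Subtype.ext_iff])

variable {R : Type u} [CommRing R] (x : Fin 2 → R) {N : Type v} [AddCommGroup N] [Module R N]

/-- The Euler characteristic of homology equals that of the complex `N → N² → N`, which is `ℓ(N) -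
2ℓ(N) + ℓ(N) = 0`. -/
theorem koszulEuler_eq_zero_of_length_ne_top (hN : Module.length R N ≠ ⊤) :
    koszulEuler x N = 0 := by
  obtain ⟨e0⟩ := nonempty_koszulHomology_zero_equiv x N
  obtain ⟨e1⟩ := nonempty_koszulHomology_one_equiv x N
  obtain ⟨e2⟩ := nonempty_koszulHomology_two_equiv x N
  have hle : LinearMap.range (koszulPairLeft x N) ≤ LinearMap.ker (koszulPairRight x N) :=
    LinearMap.range_le_ker_iff.2 (koszulPairRight_comp_koszulPairLeft x N)
  have h0 := length_eq_length_add_quotient (LinearMap.range (koszulPairRight x N))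
  have hB := length_eq_length_ker_add_range (koszulPairRight x N)
  have hA := length_eq_length_ker_add_range (koszulPairLeft x N)
  let K := (LinearMap.range (koszulPairLeft x N)).comap
    (LinearMap.ker (koszulPairRight x N)).subtype
  have h1 := length_eq_length_add_quotient K
  have hK : Module.length R K = Module.length R (LinearMap.range (koszulPairLeft x N)) := by
    let e : K ≃ₗ[R] LinearMap.range (koszulPairLeft x N) := Submodule.comapSubtypeEquivOfLe hle
    exact LinearEquiv.length_eq (M := K) e
  rw [hK] at h1
  rw [Module.length_prod] at hB
  rw [h1] at hB
  have hH : Module.length R ((koszulComplex x N).homology 1) =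
      Module.length R (LinearMap.ker (koszulPairRight x N) ⧸ K) := e1.length_eq
  rw [koszulEuler, koszulLength, koszulLength, koszulLength, e0.length_eq, hH, e2.length_eq]
  lift Module.length R N to ℕ using hN with l
  generalize Module.length R (LinearMap.range (koszulPairRight x N)) = r at *
  generalize Module.length R (LinearMap.range (koszulPairLeft x N)) = s at *
  generalize Module.length R (LinearMap.ker (koszulPairLeft x N)) = k at *
  generalize Module.length R (N ⧸ LinearMap.range (koszulPairRight x N)) = h at *
  generalize Module.length R (LinearMap.ker (koszulPairRight x N) ⧸ K) = t at *
  -- An infinite value of any of these lengths contradicts the finiteness of `ℓ(N)`; only the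
  -- all-finite case survives.
  cases r <;> cases s <;> cases k <;> cases h <;> cases t <;> try simp at h0 hA hB
  norm_cast at h0 hA hB
  simp only [ENat.toNat_natCast]
  omega

theorem koszulLength_two_eq_zero_of_injective
    (h : Function.Injective (koszulPairLeft x N)) : koszulLength x N 2 = 0 := by
  obtain ⟨e⟩ := nonempty_koszulHomology_two_equiv x N
  have : Subsingleton (LinearMap.ker (koszulPairLeft x N)) := by
    rw [LinearMap.ker_eq_bot.2 h]
    infer_instance
  rw [koszulLength, e.length_eq, Module.length_eq_zero, ENat.toNat_zero]

/-- When `x₀` is regular, `H₂ = 0`, while `H₁` and `H₀` are the kernel and cokernel of `x₁` on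
`N/x₀N`. An endomorphism of a finite length module has kernel and cokernel of equal length. -/
theorem koszulEuler_eq_zero_of_isSMulRegular_zero (h0 : IsSMulRegular N (x 0))
    (hQ : Module.length R (N ⧸ LinearMap.range (LinearMap.lsmul R N (x 0))) ≠ ⊤) :
    koszulEuler x N = 0 := by
  obtain ⟨e0⟩ := nonempty_koszulHomology_zero_equiv x N
  obtain ⟨e1⟩ := nonempty_koszulHomology_one_equiv x N
  have h2 := koszulLength_two_eq_zero_of_injective x (N := N)
    fun m n h => h0 (Prod.ext_iff.1 h).2
  let P := LinearMap.range (LinearMap.lsmul R N (x 0))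
  let φ : N ⧸ P →ₗ[R] N ⧸ P := LinearMap.lsmul R _ (x 1)
  let ψ : LinearMap.ker (koszulPairRight x N) →ₗ[R] LinearMap.ker φ :=
    LinearMap.codRestrict _ (P.mkQ ∘ₗ LinearMap.snd R N N ∘ₗ Submodule.subtype _) (by
      rintro ⟨⟨p, q⟩, h⟩
      rw [LinearMap.mem_ker, koszulPairRight_apply] at h
      refine (Submodule.Quotient.mk_eq_zero P).2 ⟨-p, ?_⟩
      simpa using neg_eq_of_add_eq_zero_right h)
  have hψ : Function.Surjective ψ := by
    rintro ⟨z, hz⟩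
    obtain ⟨q, rfl⟩ := P.mkQ_surjective z
    obtain ⟨r, hr⟩ := (Submodule.Quotient.mk_eq_zero P).1 hz
    exact ⟨⟨(-r, q), by
      rw [LinearMap.mem_ker, koszulPairRight_apply]
      simp only [LinearMap.lsmul_apply] at hr
      simp [hr]⟩, rfl⟩
  have hker : LinearMap.ker ψ = (LinearMap.range (koszulPairLeft x N)).comap
      (LinearMap.ker (koszulPairRight x N)).subtype := by
    ext ⟨⟨p, q⟩, h⟩
    rw [LinearMap.mem_ker, koszulPairRight_apply] at h
    rw [LinearMap.mem_ker, Subtype.ext_iff]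
    refine (Submodule.Quotient.mk_eq_zero P).trans ⟨?_, ?_⟩
    · rintro ⟨m, hm⟩
      refine ⟨m, Prod.ext (h0 ?_) hm⟩
      have hm : x 0 • m = q := hm
      subst hm
      simp only [koszulPairLeft_apply, smul_neg, Submodule.subtype_apply]
      rw [smul_comm]
      exact neg_eq_of_add_eq_zero_left h
    · rintro ⟨m, hm⟩
      exact ⟨m, (Prod.ext_iff.1 hm).2⟩
  have l1 := (e1.trans ((Submodule.quotEquivOfEq _ _ hker.symm).trans
    (ψ.quotKerEquivOfSurjective hψ))).length_eq
  let θ : N →ₗ[R] (N ⧸ P) ⧸ LinearMap.range φ := (LinearMap.range φ).mkQ ∘ₗ P.mkQ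
  have hθ : LinearMap.ker θ = LinearMap.range (koszulPairRight x N) := by
    ext n
    refine (Submodule.Quotient.mk_eq_zero (LinearMap.range φ)).trans ⟨?_, ?_⟩
    · rintro ⟨z, hz⟩
      obtain ⟨q, rfl⟩ := P.mkQ_surjective z
      obtain ⟨p, hp⟩ := (Submodule.Quotient.eq P).1 hz.symm
      refine ⟨(p, q), ?_⟩
      simp only [LinearMap.lsmul_apply] at hp
      simp [hp]
    · rintro ⟨⟨p, q⟩, rfl⟩
      refine ⟨P.mkQ q, ((Submodule.Quotient.eq P).2 ⟨p, ?_⟩).symm⟩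
      simp
  have l0 := (e0.trans ((Submodule.quotEquivOfEq _ _ hθ.symm).trans
    (θ.quotKerEquivOfSurjective
      ((Submodule.mkQ_surjective _).comp (Submodule.mkQ_surjective _))))).length_eq
  have ha := length_eq_length_add_quotient (LinearMap.range φ)
  have hb := length_eq_length_ker_add_range φ
  have hr : Module.length R (LinearMap.range φ) ≠ ⊤ := by
    intro hr
    rw [ha, hr, top_add] at hQ
    exact hQ rfl
  have : Module.length R (LinearMap.ker φ) = Module.length R ((N ⧸ P) ⧸ LinearMap.range φ) := by
    rw [ha, add_comm] at hb
    exact ((ENat.add_left_injective_of_ne_top hr) hb).symm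
  rw [koszulEuler, h2, koszulLength, koszulLength, l0, l1, this]
  simp

/-- Here `H₂ = 0`, the 1-cycles are `N × 0` and the 1-boundaries are `x₁N × 0`, so `H₁ ≅ N/x₁N ≅
H₀`. -/
theorem koszulEuler_eq_zero_of_isSMulRegular_one (h0 : ∀ n : N, x 0 • n = 0)
    (h1 : IsSMulRegular N (x 1)) : koszulEuler x N = 0 := by
  obtain ⟨e0⟩ := nonempty_koszulHomology_zero_equiv x N
  obtain ⟨e1⟩ := nonempty_koszulHomology_one_equiv x N
  have h2 := koszulLength_two_eq_zero_of_injective x (N := N)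
    fun m n h => h1 (neg_injective (Prod.ext_iff.1 h).1)
  let ψ : LinearMap.ker (koszulPairRight x N) →ₗ[R] N ⧸ LinearMap.range (koszulPairRight x N) :=
    Submodule.mkQ _ ∘ₗ LinearMap.fst R N N ∘ₗ Submodule.subtype _
  have hψ : Function.Surjective ψ := by
    intro z
    obtain ⟨p, rfl⟩ := Submodule.mkQ_surjective _ z
    exact ⟨⟨(p, 0), by simp [h0]⟩, rfl⟩
  have hker : LinearMap.ker ψ = (LinearMap.range (koszulPairLeft x N)).comap
      (LinearMap.ker (koszulPairRight x N)).subtype := by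
    ext ⟨⟨p, q⟩, h⟩
    rw [LinearMap.mem_ker, koszulPairRight_apply] at h
    have hq : q = 0 := h1 (by simpa [h0] using h)
    subst hq
    refine (Submodule.Quotient.mk_eq_zero _).trans ⟨?_, ?_⟩
    · rintro ⟨⟨m, n⟩, hm⟩
      refine ⟨-n, ?_⟩
      simpa [h0] using hm
    · rintro ⟨m, hm⟩
      refine ⟨(0, -m), ?_⟩
      simpa [h0] using (Prod.ext_iff.1 hm).1
  have l1 := (e1.trans ((Submodule.quotEquivOfEq _ _ hker.symm).trans
    (ψ.quotKerEquivOfSurjective hψ))).length_eq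
  rw [koszulEuler, h2, koszulLength, koszulLength, e0.length_eq, l1]
  simp

end EulerVanishing

/-! ### Vanishing of the Euler characteristic on torsion modules. -/

section Torsion

variable {R : Type u} [CommRing R] [IsDomain R] [IsLocalRing R] [IsNoetherianRing R]
  {x : Fin 2 → R}

/-- Over a two-dimensional local domain, the Koszul Euler characteristic of a pair generating a
primary ideal vanishes on modules with nonzero annihilator. -/
theorem koszulEuler_eq_zero_of_annihilator (hdim : ringKrullDim R = 2)
    (hx : IsLocalRing.maximalIdeal R ≤ (Ideal.span (Set.range x)).radical)
    {a : R} (ha : a ≠ 0) (N : Type v) [AddCommGroup N] [Module R N] (hN : Module.Finite R N)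
    (haN : a ∈ Module.annihilator R N) : koszulEuler x N = 0 := by
  revert haN
  -- Prime filtration: `χ` is additive and annihilation by `a` passes to submodules and quotients,
  -- so `N ≅ R/p` is the essential case. There every element of `R` either kills `N` or is regular
  -- on it.
  induction hN using IsNoetherianRing.induction_on_isQuotientEquivQuotientPrime R with
  | subsingleton N =>
    exact fun _ => koszulEuler_eq_zero_of_length_ne_top x (by simp [Module.length_eq_zero])
  | quotient N p e =>
    intro haN
    have hann (r : R) (hr : r ∈ p.1) (n : N) : r • n = 0 := by
      apply e.injective
      obtain ⟨s, hs⟩ := Ideal.Quotient.mk_surjective (e n)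
      rw [map_smul, map_zero, ← hs]
      exact Ideal.Quotient.eq_zero_iff_mem.2 (p.1.mul_mem_right s hr)
    have hreg (r : R) (hr : r ∉ p.1) : IsSMulRegular N r := by
      intro m n hmn
      apply e.injective
      have h : r • e m = r • e n := by rw [← map_smul, ← map_smul]; exact congrArg e hmn
      rw [Algebra.smul_def, Algebra.smul_def] at h
      exact mul_left_cancel₀ (fun h => hr (Ideal.Quotient.eq_zero_iff_mem.1 h)) h
    -- The nonzero element `a` lies in `p`, so `R/p` has dimension at most one.
    have hp : p.1 ≠ ⊥ := by
      intro hp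
      have h : a • e.symm 1 = 0 := Module.mem_annihilator.1 haN _
      rw [← map_smul, LinearEquiv.map_eq_zero_iff, Algebra.smul_def, mul_one] at h
      have h := Ideal.Quotient.eq_zero_iff_mem.1 h
      rw [hp] at h
      exact ha h
    by_cases h0 : x 0 ∈ p.1
    · by_cases h1 : x 1 ∈ p.1
      · exact koszulEuler_eq_zero_of_length_ne_top x
          (length_ne_top_of_smul_eq_zero hx N (hann _ h0) (hann _ h1))
      · exact koszulEuler_eq_zero_of_isSMulRegular_one x (hann _ h0) (hreg _ h1)
    · refine koszulEuler_eq_zero_of_isSMulRegular_zero x (hreg _ h0) ?_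
      -- `N/x₀N` is killed by `p + (x₀)`, whose radical contains `𝔪` because `p` is nonzero and `x₀
      -- ∉ p`.
      refine length_ne_top_of_maximalIdeal_le_radical (maximalIdeal_le_radical_of_notMem hdim
        (P := p.1) (I := p.1 ⊔ Ideal.span {x 0}) hp le_sup_left h0
        (Ideal.mem_sup_right (Ideal.mem_span_singleton_self _))) (sup_le ?_ ?_)
      · intro r hr
        refine Module.mem_annihilator.2 fun z => ?_
        obtain ⟨n, rfl⟩ := Submodule.mkQ_surjective _ z
        rw [← map_smul, hann r hr, map_zero]
      · rw [Ideal.span_singleton_le_iff_mem]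
        refine Module.mem_annihilator.2 fun z => ?_
        obtain ⟨n, rfl⟩ := Submodule.mkQ_surjective _ z
        exact (Submodule.Quotient.mk_eq_zero _).2 ⟨n, rfl⟩
  | exact N₁ N₂ N₃ f g hf hg hfg h₁ h₃ =>
    intro h
    rw [koszulEuler_eq_add x hfg hf hg (length_koszulHomology_ne_top hx N₁)
      (length_koszulHomology_ne_top hx N₂) (length_koszulHomology_ne_top hx N₃),
      h₁ (f.annihilator_le_of_injective hf h), h₃ (g.annihilator_le_of_surjective hg h), add_zero]

end Torsion

/-! ### Comparing `M` with its quotient by a torsion submodule. -/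

section Comparison

variable {R : Type u} [CommRing R]

theorem range_koszulPairRight (x : Fin 2 → R) (M : Type v) [AddCommGroup M] [Module R M] :
    LinearMap.range (koszulPairRight x M) =
      Ideal.span (Set.range x) • (⊤ : Submodule R M) := by
  apply le_antisymm
  · rintro _ ⟨⟨p, q⟩, rfl⟩
    rw [koszulPairRight_apply]
    exact add_mem
      (Submodule.smul_mem_smul (Ideal.subset_span (Set.mem_range_self 0)) Submodule.mem_top)
      (Submodule.smul_mem_smul (Ideal.subset_span (Set.mem_range_self 1)) Submodule.mem_top)
  · refine Submodule.smul_le.2 fun r hr n _ => ?_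
    induction hr using Submodule.span_induction with
    | mem r hr =>
      obtain ⟨i, rfl⟩ := hr
      fin_cases i
      · exact ⟨(n, 0), by simp⟩
      · exact ⟨(0, n), by simp⟩
    | zero => simp
    | add r s _ _ hr hs => rw [add_smul]; exact add_mem hr hs
    | smul a r _ hr => rw [smul_eq_mul, mul_smul]; exact Submodule.smul_mem _ a hr

theorem koszulLength_zero_eq (x : Fin 2 → R) (M : Type v) [AddCommGroup M] [Module R M] :
    koszulLength x M 0 =
      (Module.length R (M ⧸ Ideal.span (Set.range x) • (⊤ : Submodule R M))).toNat := by
  obtain ⟨e⟩ := nonempty_koszulHomology_zero_equiv x M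
  rw [koszulLength, e.length_eq, range_koszulPairRight]

/-- Isolates the contribution `C/(C ∩ IM)` of `C`. It is used for the parameter ideal, for `𝔪`, and
for the powers of `𝔪`. -/
theorem length_quotient_smul_top_eq_add {M : Type v} [AddCommGroup M] [Module R M]
    (I : Ideal R) (C : Submodule R M) :
    Module.length R (M ⧸ I • (⊤ : Submodule R M)) =
      Module.length R (C ⧸ (I • (⊤ : Submodule R M)).comap C.subtype) +
        Module.length R ((M ⧸ C) ⧸ I • (⊤ : Submodule R (M ⧸ C))) := by
  rw [length_quotient_eq_add _ C, map_mkQ_smul_top]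

variable [IsLocalRing R] [IsNoetherianRing R]

theorem length_quotient_smul_top_ne_top {I : Ideal R}
    (hI : IsLocalRing.maximalIdeal R ≤ I.radical) (M : Type v) [AddCommGroup M] [Module R M]
    [Module.Finite R M] : Module.length R (M ⧸ I • (⊤ : Submodule R M)) ≠ ⊤ := by
  refine length_ne_top_of_maximalIdeal_le_radical hI fun r hr => Module.mem_annihilator.2 fun z => ?_
  obtain ⟨m, rfl⟩ := Submodule.mkQ_surjective _ z
  exact (Submodule.Quotient.mk_eq_zero _).2 (Submodule.smul_mem_smul hr Submodule.mem_top)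

variable {x : Fin 2 → R} {M : Type v} [AddCommGroup M] [Module R M] [Module.Finite R M]

/-- `H₂` is the submodule of elements killed by both parameters. It has finite length, so the
hypothesis on submodules makes it zero. -/
theorem koszulLength_two_eq_zero
    (hx : IsLocalRing.maximalIdeal R ≤ (Ideal.span (Set.range x)).radical)
    (hfl : ∀ N : Submodule R M, IsFiniteLength R N → N = ⊥) : koszulLength x M 2 = 0 := by
  apply koszulLength_two_eq_zero_of_injective
  rw [← LinearMap.ker_eq_bot]
  apply hfl
  obtain ⟨e⟩ := nonempty_koszulHomology_two_equiv x M
  rw [← Module.length_ne_top_iff, ← e.length_eq]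
  exact length_koszulHomology_ne_top hx M 2

omit [IsNoetherianRing R] in
theorem numGenerators_quotient_le (C : Submodule R M) :
    numGenerators R (M ⧸ C) ≤ numGenerators R M := by
  rw [← Nat.cast_le (α := ℕ∞), numGenerators_eq_length, numGenerators_eq_length,
    length_quotient_smul_top_eq_add _ C]
  exact le_add_self

/-- Passing to a quotient decreases the number of generators by at most as much as the length modulo
an ideal primary to the maximal ideal. -/
theorem numGenerators_add_koszulLength_zero_le
    (hx : (Ideal.span (Set.range x)).radical = IsLocalRing.maximalIdeal R) (C : Submodule R M) :
    numGenerators R M + koszulLength x (M ⧸ C) 0 ≤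
      numGenerators R (M ⧸ C) + koszulLength x M 0 := by
  have hI : Ideal.span (Set.range x) ≤ IsLocalRing.maximalIdeal R := hx ▸ Ideal.le_radical
  rw [← Nat.cast_le (α := ℕ∞)]
  push_cast
  rw [koszulLength_zero_eq, koszulLength_zero_eq,
    ENat.natCast_toNat (length_quotient_smul_top_ne_top hx.ge _),
    ENat.natCast_toNat (length_quotient_smul_top_ne_top hx.ge _), numGenerators_eq_length,
    numGenerators_eq_length, length_quotient_smul_top_eq_add _ C,
    length_quotient_smul_top_eq_add (Ideal.span (Set.range x)) C]
  -- Since `I ⊆ 𝔪`, the module `C/(C ∩ IM)` surjects onto `C/(C ∩ 𝔪M)`.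
  have h : Module.length R
      (C ⧸ (IsLocalRing.maximalIdeal R • (⊤ : Submodule R M)).comap C.subtype) ≤
      Module.length R
        (C ⧸ (Ideal.span (Set.range x) • (⊤ : Submodule R M)).comap C.subtype) :=
    Module.length_le_of_surjective
      (Submodule.factor (Submodule.comap_mono (Submodule.smul_mono_left hI)))
      (Submodule.factor_surjective _)
  rw [add_comm (Module.length R (C ⧸ _)), add_assoc]
  gcongr

variable [IsDomain R]

/-- Passage to a quotient by a torsion submodule. -/
theorem chiOne_eq_add (hdim : ringKrullDim R = 2)
    (hx : IsLocalRing.maximalIdeal R ≤ (Ideal.span (Set.range x)).radical) {C : Submodule R M}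
    (hC : Module.IsTorsion R C) (hfl : ∀ N : Submodule R (M ⧸ C), IsFiniteLength R N → N = ⊥) :
    chiOne x M + koszulLength x (M ⧸ C) 0 = koszulLength x (M ⧸ C) 1 + koszulLength x M 0 := by
  obtain ⟨a, ha, ha0⟩ := exists_mem_annihilator_of_isTorsion hC
  -- Additivity along `0 → C → M → M/C → 0`, where `χ(C) = 0` and `h₂(M/C) = 0`.
  have h := koszulEuler_eq_add x (LinearMap.exact_subtype_mkQ C) C.subtype_injective
    C.mkQ_surjective (length_koszulHomology_ne_top hx _) (length_koszulHomology_ne_top hx _)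
    (length_koszulHomology_ne_top hx _)
  rw [koszulEuler_eq_zero_of_annihilator hdim hx ha0 C inferInstance ha, koszulEuler, koszulEuler,
    koszulLength_two_eq_zero hx hfl] at h
  rw [chiOne_eq]
  push_cast at h
  linarith

/-- If `a ≠ 0` kills `C` and `b` kills `M/C`, then `ab` kills `M`; hence `ab = 0` and `b = 0`. -/
theorem annihilator_quotient_eq_bot {C : Submodule R M}
    (hC : Module.IsTorsion R C) (hM : Module.annihilator R M = ⊥) :
    Module.annihilator R (M ⧸ C) = ⊥ := by
  obtain ⟨a, ha, ha0⟩ := exists_mem_annihilator_of_isTorsion hC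
  rw [eq_bot_iff]
  intro b hb
  have : a * b ∈ Module.annihilator R M := by
    refine Module.mem_annihilator.2 fun m => ?_
    have h : b • m ∈ C := (Submodule.Quotient.mk_eq_zero C).1 (Module.mem_annihilator.1 hb (C.mkQ m))
    rw [mul_smul]
    exact congrArg Subtype.val (Module.mem_annihilator.1 ha ⟨b • m, h⟩)
  rw [hM, Submodule.mem_bot] at this
  exact (mul_eq_zero.1 this).resolve_left ha0

omit [IsNoetherianRing R] [IsDomain R] in
theorem maximalIdeal_le_radical_pow (t : ℕ) :
    IsLocalRing.maximalIdeal R ≤ (IsLocalRing.maximalIdeal R ^ t).radical :=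
  fun _ hr => ⟨t, Ideal.pow_mem_pow hr t⟩

/-- The Hilbert–Samuel function changes at most linearly modulo a torsion submodule. -/
theorem exists_length_quotient_pow_le (hdim : ringKrullDim R = 2) {C : Submodule R M}
    (hC : Module.IsTorsion R C) : ∃ K : ℕ, ∀ t : ℕ,
      (Module.length R (M ⧸ IsLocalRing.maximalIdeal R ^ t • (⊤ : Submodule R M))).toNat ≤
        t * K + (Module.length R
          ((M ⧸ C) ⧸ IsLocalRing.maximalIdeal R ^ t • (⊤ : Submodule R (M ⧸ C)))).toNat := by
  obtain ⟨a, ha, ha0⟩ := exists_mem_annihilator_of_isTorsion hC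
  obtain ⟨y, hy, hay⟩ := exists_maximalIdeal_le_radical_span_pair hdim ha0
  have hK : Module.length R (C ⧸ LinearMap.range (LinearMap.lsmul R C y)) ≠ ⊤ := by
    refine length_ne_top_of_maximalIdeal_le_radical hay (Ideal.span_le.2 ?_)
    rintro _ (rfl | rfl) <;> refine Module.mem_annihilator.2 fun z => ?_ <;>
      obtain ⟨c, rfl⟩ := Submodule.mkQ_surjective _ z
    · rw [← map_smul, Module.mem_annihilator.1 ha, map_zero]
    · exact (Submodule.Quotient.mk_eq_zero _).2 ⟨c, rfl⟩
  -- `K = ℓ(C/yC)`, finite because `a` and `y` both kill `C/yC`. As `yᵗC ⊆ C ∩ 𝔪ᵗM`, the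
  -- contribution of `C` is at most `ℓ(C/yᵗC) ≤ tK`.
  refine ⟨(Module.length R (C ⧸ LinearMap.range (LinearMap.lsmul R C y))).toNat, fun t => ?_⟩
  rw [← Nat.cast_le (α := ℕ∞)]
  push_cast
  rw [ENat.natCast_toNat hK,
    ENat.natCast_toNat (length_quotient_smul_top_ne_top (maximalIdeal_le_radical_pow t) _),
    ENat.natCast_toNat (length_quotient_smul_top_ne_top (maximalIdeal_le_radical_pow t) _),
    length_quotient_smul_top_eq_add _ C]
  gcongr
  refine le_trans ?_ (length_quotient_range_lsmul_pow_le y t)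
  refine Module.length_le_of_surjective (Submodule.factor (?_ :
    LinearMap.range (LinearMap.lsmul R C (y ^ t)) ≤ _)) (Submodule.factor_surjective _)
  rintro _ ⟨c, rfl⟩
  exact Submodule.smul_mem_smul (Ideal.pow_mem_pow hy t) Submodule.mem_top

/-- Both modules have dimension two, and their Hilbert–Samuel functions differ by at most `tK`,
which is negligible against `t²`. -/
theorem IsMultiplicity.quotient (hdim : ringKrullDim R = 2) {C : Submodule R M}
    (hC : Module.IsTorsion R C) (hM : Module.annihilator R M = ⊥) {e : ℝ}
    (he : IsMultiplicity R M e) : IsMultiplicity R (M ⧸ C) e := by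
  obtain ⟨d, hd, hlim⟩ := he
  have hd2 : d = 2 := by
    have := (supportDim_eq_iff_annihilator_eq_bot hdim (N := M)).2 hM
    rw [hd, hdim] at this
    exact_mod_cast this
  subst hd2
  refine ⟨2, ((supportDim_eq_iff_annihilator_eq_bot hdim).2
    (annihilator_quotient_eq_bot hC hM)).trans hdim, ?_⟩
  obtain ⟨K, hK⟩ := exists_length_quotient_pow_le hdim hC
  -- The error after normalization is `2! · tK / t² = 2K/t`.
  have hlow : Tendsto (fun t : ℕ => 2 * (K : ℝ) / t) atTop (𝓝 0) :=
    tendsto_const_div_atTop_nhds_zero_nat _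
  refine tendsto_of_tendsto_of_tendsto_of_le_of_le' (by simpa using hlim.sub hlow) hlim ?_ ?_
  · filter_upwards [eventually_gt_atTop 0] with t ht
    have ht' : (0 : ℝ) < t := by exact_mod_cast ht
    have h : ((Module.length R (M ⧸ IsLocalRing.maximalIdeal R ^ t •
        (⊤ : Submodule R M))).toNat : ℝ) ≤ t * K + (Module.length R
          ((M ⧸ C) ⧸ IsLocalRing.maximalIdeal R ^ t • (⊤ : Submodule R (M ⧸ C)))).toNat := by
      exact_mod_cast hK t
    have e : 2 * (K : ℝ) / t = 2 * ((t * K) / (t : ℝ) ^ 2) := by field_simp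
    rw [e, Nat.factorial_two, Nat.cast_two, ← mul_sub, ← sub_div]
    gcongr
    linarith
  · refine Eventually.of_forall fun t => ?_
    gcongr
    · exact length_quotient_smul_top_ne_top (maximalIdeal_le_radical_pow t) _
    · rw [length_quotient_smul_top_eq_add _ C]
      exact le_add_self

end Comparison

/-! ### The squeeze argument. -/

section Limits

/-- To be read with `N = ν(M)`, `P = ν(M/C)`, `b = h₁(M/C)` and `a = χ₁(M)`. The nonnegative
quantities `N - P` and `b` are each at most `a`, and `b/P = (b/N)/(P/N)`. -/
theorem tendsto_ratio_one_and_zero {a b N P : ℕ → ℝ} (hN : ∀ n, 0 < N n)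
    (hb : ∀ n, 0 ≤ b n) (hPN : ∀ n, P n ≤ N n) (h : ∀ n, N n - P n + b n ≤ a n)
    (ha : Tendsto (fun n => a n / N n) atTop (𝓝 0)) :
    Tendsto (fun n => P n / N n) atTop (𝓝 1) ∧ Tendsto (fun n => b n / P n) atTop (𝓝 0) := by
  have h1 : Tendsto (fun n => P n / N n) atTop (𝓝 1) := by
    refine tendsto_of_tendsto_of_tendsto_of_le_of_le (by simpa using ha.const_sub 1)
      tendsto_const_nhds (fun n => ?_) fun n => ?_
    · have := hN n
      have : 1 - a n / N n = (N n - a n) / N n := by field_simp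
      simp only [this]
      gcongr
      linarith [h n, hb n]
    · exact (div_le_one (hN n)).2 (hPN n)
  refine ⟨h1, ?_⟩
  have h2 : Tendsto (fun n => b n / N n) atTop (𝓝 0) := by
    refine tendsto_of_tendsto_of_tendsto_of_le_of_le tendsto_const_nhds ha
      (fun n => div_nonneg (hb n) (hN n).le) fun n => ?_
    have := hN n
    simp only
    gcongr
    linarith [h n, hPN n]
  have h3 := h2.div h1 one_ne_zero
  rw [zero_div] at h3
  exact h3.congr fun n => div_div_div_cancel_right₀ (hN n).ne' _ _

end Limits

/-! ### Assembly of the theorem. -/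

section Main

variable {R : Type u} [CommRing R] [IsLocalRing R] [IsDomain R] [IsNoetherianRing R]

/-- The limit of the ratio of generator numbers is recorded as well, since the Ulrich statement
needs it. -/
theorem IsWeaklyLimCohenMacaulay.quotient (hdim : ringKrullDim R = 2)
    {M : ℕ → Type v} [∀ n, AddCommGroup (M n)] [∀ n, Module R (M n)]
    {C : ∀ n, Submodule R (M n)} (hC : ∀ n, Module.IsTorsion R (C n))
    (hfl : ∀ n, ∀ N : Submodule R (M n ⧸ C n), IsFiniteLength R N → N = ⊥)
    (hM : IsWeaklyLimCohenMacaulay R M) : IsLimCohenMacaulay R (fun n => M n ⧸ C n) ∧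
      Tendsto (fun n => (numGenerators R (M n ⧸ C n) : ℝ) / numGenerators R (M n)) atTop (𝓝 1) := by
  obtain ⟨hfull, d, x, ⟨hd, hx⟩, hlim⟩ := hM
  have : ∀ n, Module.Finite R (M n) := fun n => (hfull n).1
  have hd2 : d = 2 := by
    rw [hdim] at hd
    exact_mod_cast hd.symm
  subst hd2
  have hann (n : ℕ) : Module.annihilator R (M n ⧸ C n) = ⊥ :=
    annihilator_quotient_eq_bot (hC n)
      ((supportDim_eq_iff_annihilator_eq_bot hdim).1 (hfull n).2.2)
  have hpos (n : ℕ) : (0 : ℝ) < numGenerators R (M n) := by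
    have := (hfull n).2.1
    rw [Nat.cast_pos, Nat.pos_iff_ne_zero, numGenerators, Ne,
      Submodule.spanFinrank_eq_zero_iff_eq_bot Module.Finite.fg_top]
    exact top_ne_bot
  -- The key inequality: the Euler characteristic identity evaluates `χ₁(M n)`, and the drop of `h₀`
  -- bounds the drop of `ν`.
  have hle (n : ℕ) : (numGenerators R (M n) : ℝ) - numGenerators R (M n ⧸ C n) +
      koszulLength x (M n ⧸ C n) 1 ≤ chiOne x (M n) := by
    have e1 := chiOne_eq_add hdim hx.ge (hC n) (hfl n)
    have e2 := numGenerators_add_koszulLength_zero_le hx (C n)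
    have e1' : (chiOne x (M n) : ℝ) + koszulLength x (M n ⧸ C n) 0 =
      koszulLength x (M n ⧸ C n) 1 + koszulLength x (M n) 0 := by exact_mod_cast e1
    have e2' : (numGenerators R (M n) : ℝ) + koszulLength x (M n ⧸ C n) 0 ≤
      numGenerators R (M n ⧸ C n) + koszulLength x (M n) 0 := by exact_mod_cast e2
    linarith
  obtain ⟨h1, h2⟩ := tendsto_ratio_one_and_zero (P := fun n => (numGenerators R (M n ⧸ C n) : ℝ))
    (b := fun n => (koszulLength x (M n ⧸ C n) 1 : ℝ)) hpos (fun n => Nat.cast_nonneg _)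
    (fun n => by exact_mod_cast numGenerators_quotient_le (C n)) hle hlim
  refine ⟨⟨fun n => ⟨inferInstance, ?_, (supportDim_eq_iff_annihilator_eq_bot hdim).2 (hann n)⟩,
    2, x, ⟨hd, hx⟩, fun i hi => ?_⟩, h1⟩
  · rw [← not_subsingleton_iff_nontrivial, ← Module.annihilator_eq_top_iff (R := R), hann n]
    exact bot_ne_top
  · match i with
    | 1 => exact h2
    | 2 => simp [koszulLength_two_eq_zero hx.ge (hfl _)]
    | i + 3 => simp [koszulLength_add_three]

end Main

end LimUlrich

theorem mainTheorem5 {R : Type u} [CommRing R] [IsDomain R] [IsLocalRing R] [IsNoetherianRing R]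
    (hdim : ringKrullDim R = 2)
    (M : ℕ → Type v) [∀ n, AddCommGroup (M n)] [∀ n, Module R (M n)]
    (C : ∀ n, Submodule R (M n)) (hC : ∀ n, Module.IsTorsion R (C n))
    (hfl : ∀ n, ∀ N : Submodule R (M n ⧸ C n), IsFiniteLength R N → N = ⊥) :
    (LimUlrich.IsWeaklyLimCohenMacaulay R M →
      LimUlrich.IsLimCohenMacaulay R (fun n => M n ⧸ C n)) ∧
    (LimUlrich.IsWeaklyLimUlrich R M →
      LimUlrich.IsLimUlrich R (fun n => M n ⧸ C n)) := by
  refine ⟨fun h => (h.quotient hdim hC hfl).1, fun ⟨h, e, he, hlim⟩ => ?_⟩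
  obtain ⟨hCM, hν⟩ := h.quotient hdim hC hfl
  have hfin : ∀ n, Module.Finite R (M n) := fun n => (h.1 n).1
  have hpos (n : ℕ) : (LimUlrich.numGenerators R (M n) : ℝ) ≠ 0 := by
    have := (h.1 n).2.1
    rw [Nat.cast_ne_zero, LimUlrich.numGenerators, Ne,
      Submodule.spanFinrank_eq_zero_iff_eq_bot Module.Finite.fg_top]
    exact top_ne_bot
  refine ⟨hCM, e, fun n => (he n).quotient hdim (hC n)
    ((LimUlrich.supportDim_eq_iff_annihilator_eq_bot hdim).1 (h.1 n).2.2), ?_⟩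
  -- With the same multiplicity `e` for `M` and `M̄`, one has `e/ν(M̄) = (e/ν(M)) / (ν(M̄)/ν(M))`.
  have := hlim.div hν one_ne_zero
  rw [div_one] at this
  exact this.congr fun n => div_div_div_cancel_right₀ (hpos n) _ _
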